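/- Let $M\ge 1$, let $\mathbb{R}^d=\mathbb{R}^{d_1}\times\dots\times\mathbb{R}^{d_M}$, and write $x=(x_1,\dots,x_M)$ with $x_m\in\mathbb{R}^{d_m}$, and $x_{-m}=(x_i)_{i\ne m}$. Let $\pi(\mathrm{d}x)=\exp(-U(x))\,\mathrm{d}x$ be a probability measure on $\mathbb{R}^d$, where $U:\mathbb{R}^d\to\mathbb{R}$ decomposes as $$U(x)=U_0(x)+\sum_{m=1}^M U_m(x_m),$$ with $U_m:\mathbb{R}^{d_m}\to\mathbb{R}$ convex for every $m$ and $U_0:\mathbb{R}^d\to\mathbb{R}$ of class $C^1$. Suppose that there are constants $L_1,\dots,L_M\ge 0$, with $L_m>0$ for at least one $m$ such that $d_m\ge 1$, and $\lambda^*>0$ such that: (i) for every $m$ and every fixed $\bar x_{-m}$, the map $x_m\mapsto\nabla_m U_0(x_m,\bar x_{-m})$ is $L_m$-Lipschitz for the Euclidean norm, where $\nabla_m$ is the gradient with respect to the $m$-th block; (ii) the function $x\mapsto U_0(x)-\frac{\lambda^*}{2}\|x\|_L^2$ is convex, where $\|x\|_L^2=\sum_{m=1}^M L_m\|x_m\|^2$.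 Set $\kappa^*=1/\lambda^*$. Then for every probability measure $\mu$ on $\mathbb{R}^d$, $$\frac1M\sum_{m=1}^M \mathrm{KL}(\mu_{-m}\,|\,\pi_{-m})\le\Bigl(1-\frac{1}{\kappa^*M}\Bigr)\mathrm{KL}(\mu\,|\,\pi),$$ where $\mu_{-m},\pi_{-m}$ are the laws of $x_{-m}$ under $\mu,\pi$, and $\mathrm{KL}(\mu|\nu)=\int\log\frac{\mathrm{d}\mu}{\mathrm{d}\nu}\,\mathrm{d}\mu$ if $\mu\ll\nu$ and $+\infty$ otherwise, with the convention $0\cdot\infty=0$. -/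

import Mathlib

open MeasureTheory InformationTheory
open scoped ENNReal NNReal

noncomputable section

/-- The product `ℝ^{d_1} × ⋯ × ℝ^{d_M}` of Euclidean spaces. -/
abbrev BlockSpace {M : ℕ} (d : Fin M → ℕ) : Type :=
  ∀ m : Fin M, EuclideanSpace ℝ (Fin (d m))

/-- The product of all the blocks except the `m`-th one. -/
abbrev BlockSpaceErase {M : ℕ} (d : Fin M → ℕ) (m : Fin M) : Type :=
  ∀ i : {i : Fin M // i ≠ m}, EuclideanSpace ℝ (Fin (d i))

/-- The projection `x ↦ x_{-m}`, which forgets the `m`-th block. -/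
def eraseBlock {M : ℕ} (d : Fin M → ℕ) (m : Fin M) (x : BlockSpace d) : BlockSpaceErase d m :=
  fun i => x i

/-- The projection `x ↦ x_{-m}` is measurable, so `Measure.map` along it is the push-forward. -/
theorem measurable_eraseBlock {M : ℕ} (d : Fin M → ℕ) (m : Fin M) :
    Measurable (eraseBlock d m) :=
  measurable_pi_lambda _ fun i => measurable_pi_apply (i : Fin M)

/-- The marginal `μ_{-m}` of `μ` on the product of all the blocks except the `m`-th one. -/
def marginalErase {M : ℕ} {d : Fin M → ℕ} (m : Fin M) (μ : Measure (BlockSpace d)) :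
    Measure (BlockSpaceErase d m) :=
  μ.map (eraseBlock d m)

/-- `‖x‖_L² = ∑ m, L_m ‖x_m‖²`. -/
def blockNormSq {M : ℕ} {d : Fin M → ℕ} (L : Fin M → ℝ≥0) (x : BlockSpace d) : ℝ :=
  ∑ m, (L m : ℝ) * ‖x m‖ ^ 2

/-- The gradient with respect to the `m`-th block of `f` at the point `(y, x_{-m})`. -/
def blockGradient {M : ℕ} {d : Fin M → ℕ} (f : BlockSpace d → ℝ) (m : Fin M) (x : BlockSpace d)
    (y : EuclideanSpace ℝ (Fin (d m))) : EuclideanSpace ℝ (Fin (d m)) :=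
  gradient (fun z => f (Function.update x m z)) y

/-- The measure with density `exp (-U)` with respect to the Lebesgue measure. -/
def gibbsMeasure {M : ℕ} {d : Fin M → ℕ} (U : BlockSpace d → ℝ) : Measure (BlockSpace d) :=
  volume.withDensity fun x => ENNReal.ofReal (Real.exp (-U x))

/-- The block assumption on `π`, with decomposition `U x = U₀ x + ∑ m, V m (x m)`, block smoothness
constants `L` and convexity constant `lam` (in the norm `‖·‖_L`). -/
structure BlockAssumption {M : ℕ} {d : Fin M → ℕ} (π : Measure (BlockSpace d))
    (U U₀ : BlockSpace d → ℝ) (V : ∀ m : Fin M, EuclideanSpace ℝ (Fin (d m)) → ℝ)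
    (L : Fin M → ℝ≥0) (lam : ℝ) : Prop where
  isProbabilityMeasure : IsProbabilityMeasure π
  eq_gibbs : π = gibbsMeasure U
  decomposition : ∀ x, U x = U₀ x + ∑ m, V m (x m)
  convex_separable : ∀ m, ConvexOn ℝ Set.univ (V m)
  contDiff : ContDiff ℝ 1 U₀
  block_smooth : ∀ (m : Fin M) (x : BlockSpace d), LipschitzWith (L m) (blockGradient U₀ m x)
  lam_pos : 0 < lam
  strongly_convex : ConvexOn ℝ Set.univ fun x => U₀ x - lam / 2 * blockNormSq L x

/-- The coordinate-wise condition number `κ* = 1 / λ*`. -/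
def blockConditionNumber (lam : ℝ) : ℝ := 1 / lam

end

/-! The entropy bound is dual to a Brascamp-Lieb type inequality (`lintegral_prod_rpow_le`): if `g
m` depends only on `x_{-m}`, then `(∫ ∏ g m ^ (1 / (M - l)) dπ) ^ (M - l) ≤ ∏ ∫ g m dπ_{-m}`. For `g
m = dμ_{-m}/dπ_{-m}` the right side is 1, and Gibbs' variational inequality tested on the product on
the left says exactly that the marginal entropies sum to at most `(M - l) KL(μ | π)`. Letting `l`
increase to `λ*` gives the theorem.

The functional inequality comes from a Prékopa-Leindler inequality (`prekopaLeindler_blocks`)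
comparing `x` and `y` with the `M` points obtained from `x` by moving one block a fraction `l`
towards `y`. The `m`-th function ignores block `m`, so it does not see the move, and only `exp (-U)`
has to be controlled. This is `sum_update_le`: block smoothness costs `l² / 2 * ‖y - x‖_L²` in
total, strong convexity gains `l * λ* / 2 * ‖y - x‖_L²`, and `l ≤ λ*` lets the gain win; the
separable part needs only convexity.

On the line, the Prékopa-Leindler inequality for families combines the classical one, for the
function whose argument moves, with Hölder's inequality for the others. Induction over coordinates,
each coloured by its block, gives all dimensions. -/

/-! ### Brunn-Minkowski on the line -/

open scoped Pointwise in
/-- The one-dimensional Brunn-Minkowski inequality for compact sets. -/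
theorem volume_add_le_volume_add_set_of_isCompact {A B : Set ℝ} (hA : IsCompact A)
    (hB : IsCompact B) (hA0 : A.Nonempty) (hB0 : B.Nonempty) :
    volume A + volume B ≤ volume (A + B) := by
  obtain ⟨a, haA, ha⟩ := hA.exists_isGreatest hA0
  obtain ⟨b, hbB, hb⟩ := hB.exists_isLeast hB0
  have h1 : volume ((fun x => x + b) '' A) = volume A := by
    simp [Set.image_add_right, measure_preimage_add_right]
  have h2 : volume ((fun x => a + x) '' B) = volume B := by
    simp [Set.image_add_left, measure_preimage_add]
  -- With `a = max A` and `b = min B`, the translates `A + b` and `a + B` lie on either side of `a +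
  -- b`, so they overlap in at most that point.
  have hsub : ((fun x => x + b) '' A) ∪ ((fun x => a + x) '' B) ⊆ A + B := by
    rintro _ (⟨x, hx, rfl⟩ | ⟨x, hx, rfl⟩)
    · exact Set.add_mem_add hx hbB
    · exact Set.add_mem_add haA hx
  have hinter : ((fun x => x + b) '' A) ∩ ((fun x => a + x) '' B) ⊆ {a + b} := by
    rintro _ ⟨⟨x, hx, rfl⟩, ⟨y, hy, hxy⟩⟩
    have h3 := ha hx
    have h4 := hb hy
    simp only at hxy
    simp only [Set.mem_singleton_iff]
    linarith
  have hnull : volume (((fun x => x + b) '' A) ∩ ((fun x => a + x) '' B)) = 0 :=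
    measure_mono_null hinter (by simp)
  have hBm : MeasurableSet ((fun x => a + x) '' B) :=
    (hB.image (by fun_prop)).measurableSet
  calc volume A + volume B
      = volume ((fun x => x + b) '' A) + volume ((fun x => a + x) '' B) := by rw [h1, h2]
    _ = volume (((fun x => x + b) '' A) ∪ ((fun x => a + x) '' B)) := by
        rw [← measure_union_add_inter _ hBm, hnull, add_zero]
    _ ≤ volume (A + B) := measure_mono hsub

open scoped Pointwise in
/-- The one-dimensional Brunn-Minkowski inequality. -/
theorem volume_add_le_volume_add_set {A B : Set ℝ} (hA : MeasurableSet A) (hB : MeasurableSet B)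
    (hA0 : A.Nonempty) (hB0 : B.Nonempty) : volume A + volume B ≤ volume (A + B) := by
  obtain ⟨a, ha⟩ := hA0
  obtain ⟨b, hb⟩ := hB0
  refine le_of_forall_lt fun c hc => ?_
  -- Null sets are treated apart: their compact approximants could be empty, but a single translate
  -- of the other set already suffices.
  by_cases hA1 : volume A = 0
  · rw [hA1, zero_add] at hc
    refine hc.trans_le ?_
    have h2 : volume ((fun x => a + x) '' B) = volume B := by
      simp [Set.image_add_left, measure_preimage_add]
    rw [← h2]
    refine measure_mono ?_
    rintro _ ⟨x, hx, rfl⟩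
    exact Set.add_mem_add ha hx
  by_cases hB1 : volume B = 0
  · rw [hB1, add_zero] at hc
    refine hc.trans_le ?_
    have h1 : volume ((fun x => x + b) '' A) = volume A := by
      simp [Set.image_add_right, measure_preimage_add_right]
    rw [← h1]
    refine measure_mono ?_
    rintro _ ⟨x, hx, rfl⟩
    exact Set.add_mem_add hx hb
  obtain ⟨r, hr, s, hs, hrs⟩ := ENNReal.exists_lt_add_of_lt_add hc hA1 hB1
  obtain ⟨K, hKA, hK, hrK⟩ := hA.exists_lt_isCompact hr
  obtain ⟨K', hKB, hK', hsK⟩ := hB.exists_lt_isCompact hs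
  refine hrs.trans_le ((add_le_add hrK.le hsK.le).trans ?_)
  refine (volume_add_le_volume_add_set_of_isCompact hK hK' ?_ ?_).trans
    (measure_mono (Set.add_subset_add hKA hKB))
  · exact nonempty_of_measure_ne_zero (ne_bot_of_gt hrK)
  · exact nonempty_of_measure_ne_zero (ne_bot_of_gt hsK)

open scoped Pointwise in
/-- The one-dimensional Brunn-Minkowski inequality for convex combinations. -/
theorem ofReal_mul_volume_add_le {A B C : Set ℝ} {l : ℝ} (hl0 : 0 ≤ l) (hl1 : l ≤ 1)
    (hA : MeasurableSet A) (hB : MeasurableSet B) (hA0 : A.Nonempty) (hB0 : B.Nonempty)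
    (hC : ∀ a ∈ A, ∀ b ∈ B, (1 - l) * a + l * b ∈ C) :
    ENNReal.ofReal (1 - l) * volume A + ENNReal.ofReal l * volume B ≤ volume C := by
  have h1 : volume ((1 - l) • A) = ENNReal.ofReal (1 - l) * volume A := by
    simp [Measure.addHaar_smul, abs_of_nonneg (sub_nonneg.2 hl1)]
  have h2 : volume (l • B) = ENNReal.ofReal l * volume B := by
    simp [Measure.addHaar_smul, abs_of_nonneg hl0]
  rw [← h1, ← h2]
  refine (volume_add_le_volume_add_set (hA.const_smul₀ _) (hB.const_smul₀ _) hA0.smul_set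
    hB0.smul_set).trans (measure_mono ?_)
  rintro _ ⟨_, ⟨a, ha, rfl⟩, _, ⟨b, hb, rfl⟩, rfl⟩
  exact hC a ha b hb

/-! ### Classical Prékopa-Leindler on the line -/

/-- The layer cake formula for a function with values in `[0, 1]`. -/
theorem lintegral_eq_lintegral_meas_lt_of_le_one {α : Type*} [MeasurableSpace α] (μ : Measure α)
    {f : α → ℝ≥0∞} (hf : Measurable f) (hf1 : ∀ x, f x ≤ 1) :
    ∫⁻ x, f x ∂μ = ∫⁻ t in Set.Ioo (0 : ℝ) 1, μ {x | ENNReal.ofReal t < f x} := by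
  have hfin : ∀ x, f x ≠ ∞ := fun x => ((hf1 x).trans_lt ENNReal.one_lt_top).ne
  have h1 : ∫⁻ x, f x ∂μ = ∫⁻ x, ENNReal.ofReal (f x).toReal ∂μ := by
    simp_rw [ENNReal.ofReal_toReal (hfin _)]
  rw [h1, lintegral_eq_lintegral_meas_lt μ (ae_of_all _ fun _ => ENNReal.toReal_nonneg)
    hf.ennreal_toReal.aemeasurable]
  have h2 : Set.Ioi (0 : ℝ) = Set.Ioo 0 1 ∪ Set.Ici 1 := (Set.Ioo_union_Ici_eq_Ioi one_pos).symm
  rw [h2, lintegral_union measurableSet_Ici]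
  · have h3 : ∫⁻ t in Set.Ici (1 : ℝ), μ {x | t < (f x).toReal} = 0 := by
      rw [setLIntegral_congr_fun (g := fun _ => 0) measurableSet_Ici]
      · simp
      · intro t ht
        convert! measure_empty (μ := μ)
        refine Set.eq_empty_of_forall_notMem fun x hx => ?_
        have := ENNReal.toReal_mono ENNReal.one_ne_top (hf1 x)
        simp only [Set.mem_ofPred_eq, ENNReal.toReal_one, Set.mem_Ici] at *
        linarith
    rw [h3, add_zero]
    refine setLIntegral_congr_fun measurableSet_Ioo fun t ht => ?_
    simp only [ENNReal.ofReal_lt_iff_lt_toReal ht.1.le (hfin _)]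
  · rw [Set.disjoint_left]
    intro t ht ht'
    exact absurd ht.2 (not_lt.2 ht')

/-- The additive form of the one-dimensional Prékopa-Leindler inequality, for functions with
supremum one. -/
theorem ofReal_mul_lintegral_add_le {l : ℝ} (hl0 : 0 < l) (hl1 : l < 1) {f g h : ℝ → ℝ≥0∞}
    (hf : Measurable f) (hg : Measurable g) (hh : Measurable h) (hf1 : ⨆ x, f x = 1)
    (hg1 : ⨆ x, g x = 1)
    (H : ∀ x y, f x ^ (1 - l) * g y ^ l ≤ h ((1 - l) * x + l * y)) :
    ENNReal.ofReal (1 - l) * (∫⁻ x, f x) + ENNReal.ofReal l * (∫⁻ x, g x) ≤ ∫⁻ x, h x := by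
  have hl1' : 0 < 1 - l := sub_pos.2 hl1
  -- Capping `h` at 1 puts all three layer cakes over `(0, 1)`. For such levels the superlevel sets
  -- of `f` and `g` are nonempty because the suprema equal 1, as Brunn-Minkowski requires.
  have hle : ∫⁻ x, min (h x) 1 ≤ ∫⁻ x, h x := lintegral_mono fun x => min_le_left _ _
  refine le_trans ?_ hle
  rw [lintegral_eq_lintegral_meas_lt_of_le_one volume hf fun x => hf1 ▸ le_iSup f x,
    lintegral_eq_lintegral_meas_lt_of_le_one volume hg fun x => hg1 ▸ le_iSup g x,
    lintegral_eq_lintegral_meas_lt_of_le_one volume (hh.min measurable_const)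
      fun x => min_le_right _ _]
  have hm : ∀ k : ℝ → ℝ≥0∞, Measurable fun t : ℝ => volume {x | ENNReal.ofReal t < k x} := by
    intro k
    refine Antitone.measurable fun s t hst => measure_mono fun x hx => ?_
    exact (ENNReal.ofReal_le_ofReal hst).trans_lt hx
  rw [← lintegral_const_mul _ (hm f), ← lintegral_const_mul _ (hm g),
    ← lintegral_add_left ((hm f).const_mul _)]
  refine setLIntegral_mono_ae' measurableSet_Ioo (ae_of_all _ fun t ht => ?_)
  have ht1 : ENNReal.ofReal t < 1 := by simpa using ht.2
  refine ofReal_mul_volume_add_le hl0.le hl1.le (measurableSet_lt measurable_const hf)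
    (measurableSet_lt measurable_const hg) ?_ ?_ ?_
  · exact lt_iSup_iff.1 (hf1 ▸ ht1)
  · exact lt_iSup_iff.1 (hg1 ▸ ht1)
  · intro a ha b hb
    refine lt_min (lt_of_lt_of_le ?_ (H a b)) ht1
    calc ENNReal.ofReal t = ENNReal.ofReal t ^ (1 - l) * ENNReal.ofReal t ^ l := by
          rw [← ENNReal.rpow_add _ _ (by simpa using ht.1) (by simp)]
          simp
      _ < f a ^ (1 - l) * g b ^ l :=
          ENNReal.mul_lt_mul (ENNReal.rpow_lt_rpow ha hl1') (ENNReal.rpow_lt_rpow hb hl0)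

/-- The weighted inequality of arithmetic and geometric means in `ℝ≥0∞`. -/
theorem ENNReal.rpow_mul_rpow_le {l : ℝ} (hl0 : 0 < l) (hl1 : l < 1) (a b : ℝ≥0∞) :
    a ^ (1 - l) * b ^ l ≤ ENNReal.ofReal (1 - l) * a + ENNReal.ofReal l * b := by
  have hl1' : 0 < 1 - l := sub_pos.2 hl1
  by_cases ha : a = ∞
  · simp [ha, ENNReal.mul_top, hl1]
  by_cases hb : b = ∞
  · simp [hb, ENNReal.mul_top, hl0]
  lift a to ℝ≥0 using ha
  lift b to ℝ≥0 using hb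
  have h := NNReal.geom_mean_le_arith_mean2_weighted ⟨1 - l, hl1'.le⟩ ⟨l, hl0.le⟩ a b
    (NNReal.eq (show (1 - l) + l = 1 by ring))
  rw [← ENNReal.coe_rpow_of_nonneg _ hl1'.le, ← ENNReal.coe_rpow_of_nonneg _ hl0.le,
    ENNReal.ofReal_eq_coe_nnreal hl1'.le, ENNReal.ofReal_eq_coe_nnreal hl0.le]
  exact_mod_cast h

/-- The one-dimensional Prékopa-Leindler inequality for bounded functions. -/
theorem prekopaLeindler_of_iSup_ne_top {l : ℝ} (hl0 : 0 < l) (hl1 : l < 1) {f g h : ℝ → ℝ≥0∞}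
    (hf : Measurable f) (hg : Measurable g) (hh : Measurable h) (hf1 : ⨆ x, f x ≠ ∞)
    (hg1 : ⨆ x, g x ≠ ∞)
    (H : ∀ x y, f x ^ (1 - l) * g y ^ l ≤ h ((1 - l) * x + l * y)) :
    (∫⁻ x, f x) ^ (1 - l) * (∫⁻ x, g x) ^ l ≤ ∫⁻ x, h x := by
  have hl1' : 0 < 1 - l := sub_pos.2 hl1
  set s := ⨆ x, f x with hs
  set r := ⨆ x, g x with hr
  by_cases hs0 : s = 0
  · have : ∀ x, f x = 0 := fun x => le_antisymm (hs0 ▸ le_iSup f x) bot_le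
    simp [this, hl1']
  by_cases hr0 : r = 0
  · have : ∀ x, g x = 0 := fun x => le_antisymm (hr0 ▸ le_iSup g x) bot_le
    simp [this, hl0]
  have hc0 : s ^ (1 - l) * r ^ l ≠ 0 := by
    simp [hs0, hr0, hf1, hg1]
  have hct : s ^ (1 - l) * r ^ l ≠ ∞ :=
    ENNReal.mul_ne_top (ENNReal.rpow_ne_top_of_nonneg hl1'.le hf1)
      (ENNReal.rpow_ne_top_of_nonneg hl0.le hg1)
  -- The inequality is homogeneous, so both suprema can be normalised to 1; the arithmetic-geometric
  -- mean inequality then turns the additive form into the multiplicative one.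
  have key := ofReal_mul_lintegral_add_le hl0 hl1 (f := fun x => f x / s) (g := fun x => g x / r)
    (h := fun x => h x / (s ^ (1 - l) * r ^ l)) (hf.div_const _) (hg.div_const _) (hh.div_const _)
    (by rw [← ENNReal.iSup_div, ENNReal.div_self hs0 hf1])
    (by rw [← ENNReal.iSup_div, ENNReal.div_self hr0 hg1]) ?_
  · have h2 := (ENNReal.rpow_mul_rpow_le hl0 hl1 _ _).trans key
    simp only [div_eq_mul_inv] at h2
    rw [lintegral_mul_const _ hf, lintegral_mul_const _ hg, lintegral_mul_const _ hh,
      ← div_eq_mul_inv, ← div_eq_mul_inv, ← div_eq_mul_inv,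
      ENNReal.div_rpow_of_nonneg _ _ hl1'.le, ENNReal.div_rpow_of_nonneg _ _ hl0.le,
      ← ENNReal.mul_div_mul_comm (by simp [hs0, hf1]) (by simp [hr0, hg1])] at h2
    rwa [ENNReal.div_le_iff hc0 hct, ENNReal.div_mul_cancel hc0 hct] at h2
  · intro x y
    rw [ENNReal.div_rpow_of_nonneg _ _ hl1'.le, ENNReal.div_rpow_of_nonneg _ _ hl0.le,
      ← ENNReal.mul_div_mul_comm (by simp [hs0, hf1]) (by simp [hr0, hg1])]
    exact ENNReal.div_le_div_right (H x y) _

theorem tendsto_lintegral_min_natCast {α : Type*} [MeasurableSpace α] (μ : Measure α)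
    {f : α → ℝ≥0∞} (hf : Measurable f) :
    Filter.Tendsto (fun n : ℕ => ∫⁻ x, min (f x) n ∂μ) Filter.atTop (nhds (∫⁻ x, f x ∂μ)) := by
  have hmono : Monotone fun (n : ℕ) (x : α) => min (f x) (n : ℝ≥0∞) := fun m n hmn x =>
    min_le_min_left _ (by exact_mod_cast hmn)
  have h1 : ∫⁻ x, f x ∂μ = ⨆ n : ℕ, ∫⁻ x, min (f x) n ∂μ := by
    rw [← lintegral_iSup (fun n => hf.min measurable_const) hmono]
    refine lintegral_congr fun x => ?_
    rw [← inf_iSup_eq, ENNReal.iSup_natCast, inf_top_eq]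
  rw [h1]
  exact tendsto_atTop_iSup fun m n hmn => lintegral_mono (hmono hmn)

/-- The one-dimensional Prékopa-Leindler inequality. -/
theorem prekopaLeindler {l : ℝ} (hl0 : 0 < l) (hl1 : l < 1) {f g h : ℝ → ℝ≥0∞}
    (hf : Measurable f) (hg : Measurable g) (hh : Measurable h)
    (H : ∀ x y, f x ^ (1 - l) * g y ^ l ≤ h ((1 - l) * x + l * y)) :
    (∫⁻ x, f x) ^ (1 - l) * (∫⁻ x, g x) ^ l ≤ ∫⁻ x, h x := by
  have hl1' : 0 < 1 - l := sub_pos.2 hl1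
  by_cases hf0 : ∫⁻ x, f x = 0
  · simp [hf0, hl1']
  by_cases hg0 : ∫⁻ x, g x = 0
  · simp [hg0, hl0]
  have ht : Filter.Tendsto
      (fun n : ℕ => (∫⁻ x, min (f x) n) ^ (1 - l) * (∫⁻ x, min (g x) n) ^ l) Filter.atTop
      (nhds ((∫⁻ x, f x) ^ (1 - l) * (∫⁻ x, g x) ^ l)) :=
    ENNReal.Tendsto.mul ((tendsto_lintegral_min_natCast _ hf).ennrpow_const _)
      (Or.inl (by simp [hf0, hl1.le])) ((tendsto_lintegral_min_natCast _ hg).ennrpow_const _)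
      (Or.inl (by simp [hg0, hl0.le]))
  refine le_of_tendsto' ht fun n => ?_
  have hb : ∀ k : ℝ → ℝ≥0∞, ⨆ x, min (k x) (n : ℝ≥0∞) ≠ ∞ := fun k =>
    ((iSup_le fun x => min_le_right (k x) (n : ℝ≥0∞)).trans_lt (ENNReal.natCast_lt_top n)).ne
  refine prekopaLeindler_of_iSup_ne_top hl0 hl1 (hf.min measurable_const)
    (hg.min measurable_const) hh (hb f) (hb g) fun x y => le_trans ?_ (H x y)
  gcongr <;> exact min_le_left _ _

/-! ### Families of functions on the line -/

theorem volume_preimage_mul_add_eq_zero {a b : ℝ} (ha : a ≠ 0) {s : Set ℝ} (hs : volume s = 0) :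
    volume {x | a * x + b ∈ s} = 0 := by
  have h : {x | a * x + b ∈ s} = (fun x => a * x) ⁻¹' ((fun x => x + b) ⁻¹' s) := rfl
  rw [h, Real.volume_preimage_mul_left ha, measure_preimage_add_right, hs, mul_zero]

/-- Hölder's inequality for one distinguished function of exponent `1 - l` and `card ι - 1`
functions of exponent one. -/
theorem lintegral_rpow_card_sub_le {ι α : Type*} [Fintype ι] [DecidableEq ι] [MeasurableSpace α]
    {μ : Measure α} (i₀ : ι) {l : ℝ} (hl1 : l < 1) {P F : α → ℝ≥0∞} {h : ι → α → ℝ≥0∞}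
    (hP : Measurable P) (hh : ∀ i, Measurable (h i))
    (H : ∀ᵐ x ∂μ, F x ^ ((Fintype.card ι : ℝ) - l) ≤
      P x ^ (1 - l) * ∏ i ∈ Finset.univ.erase i₀, h i x) :
    (∫⁻ x, F x ∂μ) ^ ((Fintype.card ι : ℝ) - l) ≤
      (∫⁻ x, P x ∂μ) ^ (1 - l) * ∏ i ∈ Finset.univ.erase i₀, ∫⁻ x, h i x ∂μ := by
  have hl1' : 0 < 1 - l := sub_pos.2 hl1
  have hcard : (1 : ℝ) ≤ Fintype.card ι := by
    exact_mod_cast Fintype.card_pos_iff.2 ⟨i₀⟩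
  set a : ℝ := (Fintype.card ι : ℝ) - l with ha
  have ha0 : 0 < a := by linarith
  let f : ι → α → ℝ≥0∞ := Function.update h i₀ P
  -- These exponents sum to `((1 - l) + (card ι - 1)) / a = 1`, which is what forces `a = card ι -
  -- l`.
  let p : ι → ℝ := Function.update (fun _ => 1 / a) i₀ ((1 - l) / a)
  have hprod : ∀ (k : ι → ℝ≥0∞) (q : ℝ≥0∞),
      (∏ i, Function.update k i₀ q i ^ p i) ^ a = q ^ (1 - l) * ∏ i ∈ Finset.univ.erase i₀, k i := by
    intro k q
    rw [← Finset.mul_prod_erase _ _ (Finset.mem_univ i₀), ENNReal.mul_rpow_of_nonneg _ _ ha0.le,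
      ← ENNReal.prod_rpow_of_nonneg ha0.le]
    congr 1
    · simp only [p, Function.update_self]
      rw [← ENNReal.rpow_mul, div_mul_cancel₀ _ ha0.ne']
    · refine Finset.prod_congr rfl fun i hi => ?_
      have hne := Finset.ne_of_mem_erase hi
      simp only [p, Function.update_of_ne hne]
      rw [← ENNReal.rpow_mul, div_mul_cancel₀ _ ha0.ne', ENNReal.rpow_one]
  have hp : ∑ i, p i = 1 := by
    rw [← Finset.add_sum_erase _ _ (Finset.mem_univ i₀)]
    have : ∑ i ∈ Finset.univ.erase i₀, p i = ∑ i ∈ Finset.univ.erase i₀, 1 / a :=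
      Finset.sum_congr rfl fun i hi => by
        simp only [p, Function.update_of_ne (Finset.ne_of_mem_erase hi)]
    rw [this, Finset.sum_const, Finset.card_erase_of_mem (Finset.mem_univ _), Finset.card_univ,
      nsmul_eq_mul, Nat.cast_sub (by exact_mod_cast hcard)]
    simp only [p, Function.update_self]
    field_simp
    rw [ha]
    push_cast
    ring
  have hp0 : ∀ i, 0 ≤ p i := by
    intro i
    by_cases hi : i = i₀
    · subst hi
      simp only [p, Function.update_self]
      positivity
    · simp only [p, Function.update_of_ne hi]
      positivity
  have hf : ∀ i, Measurable (f i) := by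
    intro i
    by_cases hi : i = i₀
    · subst hi
      simpa only [f, Function.update_self] using hP
    · simpa only [f, Function.update_of_ne hi] using hh i
  have hfx : ∀ x, (fun i => f i x) = Function.update (fun i => h i x) i₀ (P x) := by
    intro x
    ext i
    by_cases hi : i = i₀
    · subst hi
      simp [f]
    · simp [f, hi]
  have hfint : (fun i => ∫⁻ x, f i x ∂μ) =
      Function.update (fun i => ∫⁻ x, h i x ∂μ) i₀ (∫⁻ x, P x ∂μ) := by
    ext i
    by_cases hi : i = i₀
    · subst hi
      simp [f]
    · simp [f, hi]
  have h1 : ∫⁻ x, F x ∂μ ≤ ∫⁻ x, ∏ i, f i x ^ p i ∂μ := by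
    refine lintegral_mono_ae (H.mono fun x hx => ?_)
    rw [← hprod, ENNReal.rpow_le_rpow_iff ha0] at hx
    rw [← hfx x] at hx
    exact hx
  have h2 := h1.trans (ENNReal.lintegral_prod_norm_pow_le Finset.univ
    (fun i _ => (hf i).aemeasurable) hp fun i _ => hp0 i)
  have h3 := ENNReal.rpow_le_rpow h2 ha0.le
  rw [← hprod, ← hfint]
  exact h3

/-- A Prékopa-Leindler type inequality on the line, for a family of functions of which one is
evaluated at a convex combination and the others at its first point. -/
theorem prekopaLeindler_family {ι : Type*} [Fintype ι] [DecidableEq ι] (i₀ : ι) {l : ℝ}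
    (hl0 : 0 < l) (hl1 : l < 1) {F G : ℝ → ℝ≥0∞} {h : ι → ℝ → ℝ≥0∞} (hF : Measurable F)
    (hG : Measurable G) (hh : ∀ i, Measurable (h i))
    (H : ∀ x y, F x ^ ((Fintype.card ι : ℝ) - l) * G y ^ l ≤
      ∏ i, h i (if i₀ = i then (1 - l) * x + l * y else x)) :
    (∫⁻ x, F x) ^ ((Fintype.card ι : ℝ) - l) * (∫⁻ x, G x) ^ l ≤ ∏ i, ∫⁻ x, h i x := by
  have hl1' : 0 < 1 - l := sub_pos.2 hl1
  have hcard : (1 : ℝ) ≤ Fintype.card ι := by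
    exact_mod_cast Fintype.card_pos_iff.2 ⟨i₀⟩
  have ha0 : 0 < (Fintype.card ι : ℝ) - l := by linarith
  set a : ℝ := (Fintype.card ι : ℝ) - l
  by_cases hF0 : ∫⁻ x, F x = 0
  · simp [hF0, ha0]
  by_cases hG0 : ∫⁻ x, G x = 0
  · simp [hG0, hl0]
  -- With such a `y` fixed, any zero of the right side of `H` forces a zero of `F`.
  obtain ⟨y, hy⟩ : ∃ y, G y ≠ 0 := by
    by_contra! hcon
    simp [hcon] at hG0
  have hFG : ∀ x, F x ^ a * G y ^ l = 0 → F x = 0 := by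
    intro x hx
    rcases mul_eq_zero.1 hx with hx | hx
    · exact (ENNReal.rpow_eq_zero_iff_of_pos ha0).1 hx
    · exact absurd ((ENNReal.rpow_eq_zero_iff_of_pos hl0).1 hx) hy
  let Q : ℝ → ℝ≥0∞ := fun x => ∏ i ∈ Finset.univ.erase i₀, h i x
  have hQ : Measurable Q := Finset.measurable_prod _ fun i _ => hh i
  have H' : ∀ x y, F x ^ a * G y ^ l ≤ h i₀ ((1 - l) * x + l * y) * Q x := by
    intro x y
    refine (H x y).trans_eq ?_
    rw [← Finset.mul_prod_erase _ _ (Finset.mem_univ i₀), if_pos rfl]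
    congr 1
    exact Finset.prod_congr rfl fun i hi => by rw [if_neg (Finset.ne_of_mem_erase hi).symm]
  have hQ0 : ∀ x, Q x = 0 → F x = 0 := fun x hx =>
    hFG x (le_antisymm ((H' x y).trans_eq (by rw [hx, mul_zero])) bot_le)
  -- If one of these integrals vanished, `F` would vanish almost everywhere. For `i₀` the null set
  -- is pulled back along `x ↦ (1 - l) * x + l * y`, whose slope is nonzero.
  have hne : ∀ i, ∫⁻ x, h i x ≠ 0 := by
    intro i hi
    rw [lintegral_eq_zero_iff (hh i)] at hi
    apply hF0
    rw [lintegral_eq_zero_iff hF]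
    by_cases hii : i = i₀
    · subst hii
      have h0 : volume {x | h i x ≠ 0} = 0 := ae_iff.1 hi
      have h1 := volume_preimage_mul_add_eq_zero (b := l * y) hl1'.ne' h0
      refine measure_mono_null (fun x hx => ?_) h1
      intro hx0
      exact hx (hFG x (le_antisymm ((H' x y).trans_eq (by rw [hx0, zero_mul])) bot_le))
    · filter_upwards [hi] with x hx
      exact hQ0 x (Finset.prod_eq_zero (Finset.mem_erase.2 ⟨hii, Finset.mem_univ _⟩) hx)
  by_cases htop : ∃ i, ∫⁻ x, h i x = ∞
  · obtain ⟨i, hi⟩ := htop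
    rw [← Finset.mul_prod_erase _ _ (Finset.mem_univ i), hi, ENNReal.top_mul]
    · exact le_top
    · exact Finset.prod_ne_zero_iff.2 fun j _ => hne j
  push Not at htop
  have hfin : ∀ᵐ x, Q x ≠ ∞ := by
    have : ∀ᵐ x, ∀ i, h i x < ∞ := ae_all_iff.2 fun i => ae_lt_top (hh i) (htop i)
    filter_upwards [this] with x hx
    exact ENNReal.prod_ne_top fun i _ => (hx i).ne
  -- `P ^ (1 - l)` absorbs the factors evaluated at `x`: `H'` becomes the classical hypothesis for
  -- `P`, `G`, `h i₀`, and Hölder's inequality recovers `F` from `P` and the other factors.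
  let P : ℝ → ℝ≥0∞ := fun x => (F x ^ a / Q x) ^ (1 / (1 - l))
  have hP : Measurable P := ((hF.pow_const _).div hQ).pow_const _
  have hPpow : ∀ x, P x ^ (1 - l) = F x ^ a / Q x := fun x => by
    simp only [P]
    rw [← ENNReal.rpow_mul, div_mul_cancel₀ _ hl1'.ne', ENNReal.rpow_one]
  have hPL := prekopaLeindler hl0 hl1 hP hG (hh i₀) fun x y => by
    rw [hPpow, ENNReal.mul_div_right_comm.symm]
    exact ENNReal.div_le_of_le_mul (H' x y)
  have hHolder := lintegral_rpow_card_sub_le (μ := volume) (F := F) i₀ hl1 hP hh (by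
    filter_upwards [hfin] with x hx
    rw [hPpow]
    by_cases hx0 : Q x = 0
    · rw [hQ0 x hx0, ENNReal.zero_rpow_of_pos ha0]
      exact bot_le
    · rw [ENNReal.div_mul_cancel hx0 hx])
  rw [← Finset.mul_prod_erase _ _ (Finset.mem_univ i₀)]
  calc (∫⁻ x, F x) ^ a * (∫⁻ x, G x) ^ l
      ≤ ((∫⁻ x, P x) ^ (1 - l) * ∏ i ∈ Finset.univ.erase i₀, ∫⁻ x, h i x) * (∫⁻ x, G x) ^ l := by
        gcongr
    _ = ((∫⁻ x, P x) ^ (1 - l) * (∫⁻ x, G x) ^ l) *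
          ∏ i ∈ Finset.univ.erase i₀, ∫⁻ x, h i x := by ring
    _ ≤ _ := by gcongr

/-! ### Tensorization over coordinates and blocks -/

theorem lintegral_fin_cons {n : ℕ} {f : (Fin (n + 1) → ℝ) → ℝ≥0∞} (hf : Measurable f) :
    ∫⁻ x, f x = ∫⁻ t : ℝ, ∫⁻ x : Fin n → ℝ, f (Fin.cons t x) := by
  have h := volume_preserving_piFinSuccAbove (fun _ : Fin (n + 1) => ℝ) 0
  rw [← h.symm.lintegral_comp hf]
  rw [Measure.volume_eq_prod, lintegral_prod _ (by fun_prop)]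
  simp [MeasurableEquiv.piFinSuccAbove, Fin.insertNthEquiv]

theorem measurable_fin_cons {n : ℕ} :
    Measurable fun p : ℝ × (Fin n → ℝ) => (Fin.cons p.1 p.2 : Fin (n + 1) → ℝ) := by
  refine measurable_pi_lambda _ fun i => ?_
  refine Fin.cases ?_ (fun j => ?_) i
  · exact measurable_fst
  · exact (measurable_pi_apply j).comp measurable_snd

/-- The Prékopa-Leindler type inequality for a family of functions on `Fin n → ℝ`, where the `i`-th
function is evaluated at a point whose coordinates of colour `i` have moved. -/
theorem prekopaLeindler_family_fin {ι : Type*} [Fintype ι] [DecidableEq ι] {l : ℝ} (hl0 : 0 < l)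
    (hl1 : l < 1) {n : ℕ} (c : Fin n → ι) {F G : (Fin n → ℝ) → ℝ≥0∞}
    {h : ι → (Fin n → ℝ) → ℝ≥0∞} (hF : Measurable F) (hG : Measurable G)
    (hh : ∀ i, Measurable (h i))
    (H : ∀ x y, F x ^ ((Fintype.card ι : ℝ) - l) * G y ^ l ≤
      ∏ i, h i (fun k => if c k = i then (1 - l) * x k + l * y k else x k)) :
    (∫⁻ x, F x) ^ ((Fintype.card ι : ℝ) - l) * (∫⁻ x, G x) ^ l ≤ ∏ i, ∫⁻ x, h i x := by
  induction n with
  | zero =>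
    have hv : ∀ f : (Fin 0 → ℝ) → ℝ≥0∞, ∫⁻ x, f x = f default := fun f => by
      have h0 : (volume : Measure (Fin 0 → ℝ)) = Measure.dirac default := Measure.pi_of_empty _ _
      rw [lintegral_unique, h0, measure_univ, mul_one]
      exact congrArg f (Subsingleton.elim _ _)
    simp only [hv]
    convert! H default default
  | succ n ih =>
    simp only [lintegral_fin_cons hF, lintegral_fin_cons hG, lintegral_fin_cons (hh _)]
    have hm : ∀ {f : (Fin (n + 1) → ℝ) → ℝ≥0∞}, Measurable f →
        Measurable fun t : ℝ => ∫⁻ x : Fin n → ℝ, f (Fin.cons t x) := fun hf =>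
      (hf.comp measurable_fin_cons).lintegral_prod_right'
    have hs : ∀ {f : (Fin (n + 1) → ℝ) → ℝ≥0∞}, Measurable f → ∀ t : ℝ,
        Measurable fun x : Fin n → ℝ => f (Fin.cons t x) := fun hf t =>
      hf.comp (measurable_fin_cons.comp measurable_prodMk_left)
    -- The one-dimensional inequality is applied to the slice integrals in coordinate 0; its
    -- pointwise hypothesis is the induction hypothesis on the slices.
    refine prekopaLeindler_family (c 0) hl0 hl1 (hm hF) (hm hG) (fun i => hm (hh i)) fun s t => ?_
    refine ih (fun k => c k.succ) (hs hF s) (hs hG t) (fun i => hs (hh i) _) fun x y => ?_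
    refine (H (Fin.cons s x) (Fin.cons t y)).trans_eq (Finset.prod_congr rfl fun i _ => ?_)
    congr 1
    ext k
    refine Fin.cases ?_ (fun j => ?_) k <;> simp

theorem volume_preserving_piCurry_symm {ι : Type*} [Fintype ι] (κ : ι → Type*)
    [∀ i, Fintype (κ i)] :
    MeasurePreserving (MeasurableEquiv.piCurry fun (i : ι) (_ : κ i) => ℝ).symm := by
  refine ⟨MeasurableEquiv.measurable _, Eq.symm (Measure.pi_eq fun s hs => ?_)⟩
  rw [MeasurableEquiv.map_apply]
  have h : (MeasurableEquiv.piCurry fun (i : ι) (_ : κ i) => ℝ).symm ⁻¹' Set.univ.pi s =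
      Set.univ.pi fun i => Set.univ.pi fun k => s ⟨i, k⟩ := by
    ext x
    simp [MeasurableEquiv.coe_piCurry_symm, Sigma.uncurry, Sigma.forall]
  rw [h, volume_pi_pi, ← Finset.univ_sigma_univ, Finset.prod_sigma]
  simp only [volume_pi_pi]

/-- The flattening of the coordinates of all the blocks into a single family. -/
theorem exists_measurePreserving_flatten {M : ℕ} (d : Fin M → ℕ) :
    ∃ (n : ℕ) (σ : (Σ m, Fin (d m)) ≃ Fin n) (e : (Fin n → ℝ) ≃ᵐ BlockSpace d),
      MeasurePreserving e ∧ ∀ x m k, e x m k = x (σ ⟨m, k⟩) := by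
  let σ : (Σ m, Fin (d m)) ≃ Fin (∑ m, d m) := finSigmaFinEquiv
  let e₁ := MeasurableEquiv.piCongrLeft (fun _ : Σ m, Fin (d m) => ℝ) σ.symm
  let e₂ := MeasurableEquiv.piCurry fun (m : Fin M) (_ : Fin (d m)) => ℝ
  let e₃ : (∀ m, Fin (d m) → ℝ) ≃ᵐ BlockSpace d :=
    MeasurableEquiv.piCongrRight fun m => MeasurableEquiv.toLp 2 (Fin (d m) → ℝ)
  refine ⟨_, σ, (e₁.trans e₂).trans e₃, ?_, fun x m k => ?_⟩
  · have h₁ : MeasurePreserving e₁ := volume_measurePreserving_piCongrLeft _ _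
    have h₂ : MeasurePreserving e₂ := (volume_preserving_piCurry_symm _).symm
    have h₃ : MeasurePreserving e₃ :=
      volume_preserving_pi fun m => PiLp.volume_preserving_toLp (Fin (d m))
    exact h₃.comp (h₂.comp h₁)
  · change (MeasurableEquiv.piCongrLeft (fun _ : Σ m, Fin (d m) => ℝ) σ.symm x) ⟨m, k⟩ = _
    rw [MeasurableEquiv.coe_piCongrLeft]
    have := Equiv.piCongrLeft_apply_apply (P := fun _ : Σ m, Fin (d m) => ℝ) σ.symm x (σ ⟨m, k⟩)
    simpa using this

/-- The Prékopa-Leindler type inequality for a family of functions on a product of Euclidean spaces,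
where the `m`-th function is evaluated at a point whose `m`-th block has moved. -/
theorem prekopaLeindler_blocks {M : ℕ} {d : Fin M → ℕ} {l : ℝ} (hl0 : 0 < l) (hl1 : l < 1)
    {F G : BlockSpace d → ℝ≥0∞} {h : Fin M → BlockSpace d → ℝ≥0∞} (hF : Measurable F)
    (hG : Measurable G) (hh : ∀ m, Measurable (h m))
    (H : ∀ x y, F x ^ ((M : ℝ) - l) * G y ^ l ≤
      ∏ m, h m (Function.update x m ((1 - l) • x m + l • y m))) :
    (∫⁻ x, F x) ^ ((M : ℝ) - l) * (∫⁻ x, G x) ^ l ≤ ∏ m, ∫⁻ x, h m x := by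
  obtain ⟨n, σ, e, he, hval⟩ := exists_measurePreserving_flatten d
  have key := prekopaLeindler_family_fin hl0 hl1 (fun k => (σ.symm k).1) (hF.comp e.measurable)
    (hG.comp e.measurable) (fun m => (hh m).comp e.measurable) fun x y => by
      rw [Fintype.card_fin]
      refine (H (e x) (e y)).trans_eq (Finset.prod_congr rfl fun m _ => ?_)
      simp only [Function.comp_apply]
      congr 1
      ext i k
      rw [hval]
      by_cases hi : i = m
      · subst hi
        simp [hval]
      · simp [hval, hi]
  simpa only [Function.comp_apply, he.lintegral_comp hF, he.lintegral_comp hG,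
    he.lintegral_comp (hh _), Fintype.card_fin] using key

/-! ### Convexity and smoothness of the potential -/

/-- A function whose derivative grows at most linearly lies below a parabola. -/
theorem le_add_mul_add_sq_of_deriv_le {φ φ' : ℝ → ℝ} {K : ℝ} (hφ : ∀ t, HasDerivAt φ (φ' t) t)
    (hK : ∀ t, 0 ≤ t → φ' t ≤ φ' 0 + t * K) {t : ℝ} (ht : 0 ≤ t) :
    φ t ≤ φ 0 + t * φ' 0 + K / 2 * t ^ 2 := by
  have hd : ∀ s, HasDerivAt (fun s => φ s - s * φ' 0 - K / 2 * s ^ 2) (φ' s - φ' 0 - K * s) s := by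
    intro s
    have h := ((hφ s).sub ((hasDerivAt_id s).mul_const (φ' 0))).sub
      (((hasDerivAt_id s).pow 2).const_mul (K / 2))
    convert! h using 1
    simp
    ring
  have hanti : AntitoneOn (fun s => φ s - s * φ' 0 - K / 2 * s ^ 2) (Set.Ici 0) := by
    refine antitoneOn_of_deriv_nonpos (convex_Ici 0)
      (fun s _ => (hd s).continuousAt.continuousWithinAt)
      (fun s _ => (hd s).differentiableAt.differentiableWithinAt) fun s hs => ?_
    rw [interior_Ici] at hs
    rw [(hd s).deriv]
    linarith [hK s (le_of_lt hs)]
  have := hanti (Set.mem_Ici.2 le_rfl) (Set.mem_Ici.2 ht) ht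
  simp only at this
  linarith

section Potential

variable {M : ℕ} {d : Fin M → ℕ}

theorem inner_blockGradient {f : BlockSpace d → ℝ} (hf : Differentiable ℝ f) (m : Fin M)
    (x : BlockSpace d) (z v : EuclideanSpace ℝ (Fin (d m))) :
    inner ℝ (blockGradient f m x z) v = fderiv ℝ f (Function.update x m z) (Pi.single m v) := by
  have h : HasFDerivAt (fun z => f (Function.update x m z)) _ z :=
    (hf (Function.update x m z)).hasFDerivAt.comp z (hasFDerivAt_update x z)
  rw [blockGradient, gradient, InnerProductSpace.toDual_symm_apply, h.fderiv]
  simp only [ContinuousLinearMap.comp_apply]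
  congr 1
  ext i : 1
  by_cases hi : i = m
  · subst hi
    simp
  · simp [hi]

theorem update_add_smul (m : Fin M) (x : BlockSpace d) (v : EuclideanSpace ℝ (Fin (d m))) (t : ℝ) :
    Function.update x m (x m + t • v) = x + t • (Pi.single m v : BlockSpace d) := by
  ext1 i
  by_cases hi : i = m
  · subst hi
    simp
  · simp [hi]

theorem hasDerivAt_line {f : BlockSpace d → ℝ} (hf : Differentiable ℝ f) (x v : BlockSpace d)
    (t : ℝ) : HasDerivAt (fun t : ℝ => f (x + t • v)) (fderiv ℝ f (x + t • v) v) t := by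
  have h : HasDerivAt (fun t : ℝ => x + t • v) v t := by
    simpa using ((hasDerivAt_id t).smul_const v).const_add x
  exact (hf (x + t • v)).hasFDerivAt.comp_hasDerivAt t h

/-- The descent lemma along a block. -/
theorem le_of_lipschitzWith_blockGradient {f : BlockSpace d → ℝ} (hf : Differentiable ℝ f)
    {m : Fin M} {x : BlockSpace d} {K : ℝ≥0} (hK : LipschitzWith K (blockGradient f m x))
    (v : EuclideanSpace ℝ (Fin (d m))) {t : ℝ} (ht : 0 ≤ t) :
    f (Function.update x m (x m + t • v)) ≤
      f x + t * fderiv ℝ f x (Pi.single m v) + K * ‖v‖ ^ 2 / 2 * t ^ 2 := by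
  have h := le_add_mul_add_sq_of_deriv_le (K := K * ‖v‖ ^ 2) (hasDerivAt_line hf x (Pi.single m v))
    (fun s hs => ?_) ht
  · simpa only [update_add_smul, zero_smul, add_zero] using h
  · have h0 : x + (0 : ℝ) • (Pi.single m v : BlockSpace d) = Function.update x m (x m) := by simp
    rw [h0, ← update_add_smul, ← inner_blockGradient hf, ← inner_blockGradient hf,
      ← sub_le_iff_le_add', ← inner_sub_left]
    calc inner ℝ (blockGradient f m x (x m + s • v) - blockGradient f m x (x m)) v
        ≤ ‖blockGradient f m x (x m + s • v) - blockGradient f m x (x m)‖ * ‖v‖ :=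
          real_inner_le_norm _ _
      _ ≤ K * ‖(x m + s • v) - x m‖ * ‖v‖ := by
          gcongr
          simpa only [dist_eq_norm] using hK.dist_le_mul (x m + s • v) (x m)
      _ = s * (K * ‖v‖ ^ 2) := by
          rw [add_sub_cancel_left, norm_smul, Real.norm_of_nonneg hs]
          ring

theorem blockNormSq_add_smul (L : Fin M → ℝ≥0) (x v : BlockSpace d) (t : ℝ) :
    blockNormSq L (x + t • v) = blockNormSq L x + t * (∑ m, 2 * L m * inner ℝ (x m) (v m)) +
      t ^ 2 * blockNormSq L v := by
  simp only [blockNormSq, Finset.mul_sum, ← Finset.sum_add_distrib]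
  refine Finset.sum_congr rfl fun m _ => ?_
  rw [Pi.add_apply, Pi.smul_apply, norm_add_sq_real, norm_smul, inner_smul_right, mul_pow,
    Real.norm_eq_abs, sq_abs]
  ring

/-- The first order characterization of strong convexity. -/
theorem add_fderiv_add_blockNormSq_le {f : BlockSpace d → ℝ} (hf : Differentiable ℝ f)
    {L : Fin M → ℝ≥0} {lam : ℝ}
    (hconv : ConvexOn ℝ Set.univ fun x => f x - lam / 2 * blockNormSq L x) (x v : BlockSpace d) :
    f x + fderiv ℝ f x v + lam / 2 * blockNormSq L v ≤ f (x + v) := by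
  set B := ∑ m, 2 * L m * inner ℝ (x m) (v m) with hB
  let ψ : ℝ → ℝ := fun t => f (x + t • v) - lam / 2 * blockNormSq L (x + t • v)
  have hψ : ConvexOn ℝ Set.univ ψ := by
    refine ⟨convex_univ, fun s _ t _ a b ha hb hab => ?_⟩
    have h := hconv.2 (Set.mem_univ (x + s • v)) (Set.mem_univ (x + t • v)) ha hb hab
    have he : a • (x + s • v) + b • (x + t • v) = x + (a • s + b • t) • v := by
      calc a • (x + s • v) + b • (x + t • v) = (a + b) • x + (a * s + b * t) • v := by module
        _ = _ := by rw [hab, one_smul, smul_eq_mul, smul_eq_mul]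
    rw [he] at h
    exact h
  have hd : HasDerivAt ψ (fderiv ℝ f x v - lam / 2 * B) 0 := by
    have h1 := hasDerivAt_line hf x v 0
    have h2 : HasDerivAt (fun t : ℝ => lam / 2 * blockNormSq L (x + t • v)) (lam / 2 * B) 0 := by
      simp only [blockNormSq_add_smul]
      have h3 := ((((hasDerivAt_id (0 : ℝ)).mul_const B).const_add (blockNormSq L x)).add
        (((hasDerivAt_id (0 : ℝ)).pow 2).mul_const (blockNormSq L v))).const_mul (lam / 2)
      convert! h3 using 1
      simp
    rw [zero_smul, add_zero] at h1
    exact h1.sub h2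
  have h := hψ.le_slope_of_hasDerivAt (Set.mem_univ 0) (Set.mem_univ 1) one_pos hd
  rw [slope_def_field] at h
  have hN := blockNormSq_add_smul L x v 1
  simp only [ψ, zero_smul, add_zero, one_smul, sub_zero, div_one, one_mul, one_pow] at h hN
  rw [hN, ← hB] at h
  linarith

theorem blockNormSq_single (L : Fin M → ℝ≥0) (m : Fin M) (v : EuclideanSpace ℝ (Fin (d m))) :
    blockNormSq L (Pi.single m v : BlockSpace d) = L m * ‖v‖ ^ 2 := by
  rw [blockNormSq, Finset.sum_eq_single m]
  · simp
  · intro i _ hi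
    simp [hi]
  · simp

variable {π : Measure (BlockSpace d)} {U U₀ : BlockSpace d → ℝ}
  {V : ∀ m : Fin M, EuclideanSpace ℝ (Fin (d m)) → ℝ} {L : Fin M → ℝ≥0} {lam : ℝ}

theorem BlockAssumption.differentiable (hπ : BlockAssumption π U U₀ V L lam) :
    Differentiable ℝ U₀ :=
  hπ.contDiff.differentiable one_ne_zero

theorem BlockAssumption.continuous (hπ : BlockAssumption π U U₀ V L lam) : Continuous U := by
  have hV : ∀ m, Continuous (V m) := fun m =>
    continuousOn_univ.1 ((hπ.convex_separable m).continuousOn isOpen_univ)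
  rw [funext hπ.decomposition]
  exact hπ.contDiff.continuous.add
    (continuous_finsetSum _ fun m _ => (hV m).comp (continuous_apply m))

/-- In one block direction the quadratic lower bound from strong convexity cannot exceed the upper
bound from smoothness. A unit vector in a block with `d m > 0` and `L m > 0` makes this comparison
nontrivial. -/
theorem BlockAssumption.le_one (hπ : BlockAssumption π U U₀ V L lam)
    (hL : ∃ m, 0 < d m ∧ 0 < L m) : lam ≤ 1 := by
  obtain ⟨m, hd, hLm⟩ := hL
  let v : EuclideanSpace ℝ (Fin (d m)) := EuclideanSpace.single ⟨0, hd⟩ 1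
  have hv : ‖v‖ = 1 := by simp [v]
  have h1 := le_of_lipschitzWith_blockGradient hπ.differentiable (hπ.block_smooth m 0) v zero_le_one
  have h2 := add_fderiv_add_blockNormSq_le hπ.differentiable hπ.strongly_convex 0 (Pi.single m v)
  rw [update_add_smul, one_smul, hv] at h1
  rw [blockNormSq_single, hv] at h2
  have hLm' : (0 : ℝ) < L m := hLm
  have h3 : lam * L m ≤ 1 * L m := by linarith
  exact le_of_mul_le_mul_right h3 hLm'

/-- The potential at the points obtained by moving one block of `x` towards the same block
of `y`. -/
theorem BlockAssumption.sum_update_le (hπ : BlockAssumption π U U₀ V L lam) {l : ℝ} (hl0 : 0 ≤ l)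
    (hl1 : l ≤ 1) (hlam : l ≤ lam) (x y : BlockSpace d) :
    ∑ m, U (Function.update x m ((1 - l) • x m + l • y m)) ≤ ((M : ℝ) - l) * U x + l * U y := by
  have hN : 0 ≤ blockNormSq L (y - x) := Finset.sum_nonneg fun m _ => by positivity
  have hpt : ∀ m, (1 - l) • x m + l • y m = x m + l • (y m - x m) := fun m => by module
  have hU₀ : ∑ m, U₀ (Function.update x m ((1 - l) • x m + l • y m)) ≤
      (M : ℝ) * U₀ x + l * (U₀ y - U₀ x) := by
    have h1 : ∀ m, U₀ (Function.update x m ((1 - l) • x m + l • y m)) ≤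
        U₀ x + l * fderiv ℝ U₀ x (Pi.single m ((y - x) m)) +
          l ^ 2 / 2 * (L m * ‖(y - x) m‖ ^ 2) := by
      intro m
      rw [hpt m]
      refine (le_of_lipschitzWith_blockGradient hπ.differentiable (hπ.block_smooth m x) _
        hl0).trans_eq ?_
      simp only [Pi.sub_apply]
      ring
    have h2 : ∑ m, fderiv ℝ U₀ x (Pi.single m ((y - x) m)) = fderiv ℝ U₀ x (y - x) := by
      rw [← map_sum, Finset.univ_sum_single]
    have h3 := add_fderiv_add_blockNormSq_le hπ.differentiable hπ.strongly_convex x (y - x)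
    rw [add_sub_cancel] at h3
    -- This is where `l ≤ lam` enters: the smoothness error is dominated by the strong convexity
    -- gain.
    have h4 : l * blockNormSq L (y - x) ≤ lam * blockNormSq L (y - x) := by gcongr
    calc _ ≤ _ := Finset.sum_le_sum fun m _ => h1 m
      _ = (M : ℝ) * U₀ x + l * (fderiv ℝ U₀ x (y - x) + l / 2 * blockNormSq L (y - x)) := by
          rw [Finset.sum_add_distrib, Finset.sum_add_distrib, ← Finset.mul_sum, ← Finset.mul_sum,
            h2, blockNormSq]
          simp
          ring
      _ ≤ _ := by
          gcongr
          linarith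
  have hV : ∑ m, ∑ i, V i (Function.update x m ((1 - l) • x m + l • y m) i) ≤
      (M : ℝ) * ∑ i, V i (x i) + l * (∑ i, V i (y i) - ∑ i, V i (x i)) := by
    have h1 : ∀ m, ∑ i, V i (Function.update x m ((1 - l) • x m + l • y m) i) ≤
        ∑ i, V i (x i) + l * (V m (y m) - V m (x m)) := by
      intro m
      rw [← Finset.add_sum_erase _ _ (Finset.mem_univ m),
        ← Finset.add_sum_erase _ (fun i => V i (x i)) (Finset.mem_univ m)]
      have h2 : ∑ i ∈ Finset.univ.erase m,
          V i (Function.update x m ((1 - l) • x m + l • y m) i) =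
            ∑ i ∈ Finset.univ.erase m, V i (x i) :=
        Finset.sum_congr rfl fun i hi => by rw [Function.update_of_ne (Finset.ne_of_mem_erase hi)]
      have h3 := (hπ.convex_separable m).2 (Set.mem_univ (x m)) (Set.mem_univ (y m))
        (sub_nonneg.2 hl1) hl0 (sub_add_cancel 1 l)
      rw [h2, Function.update_self]
      simp only [smul_eq_mul] at h3
      linarith
    calc _ ≤ _ := Finset.sum_le_sum fun m _ => h1 m
      _ = _ := by
          rw [Finset.sum_add_distrib, ← Finset.mul_sum, Finset.sum_sub_distrib]
          simp
  simp only [hπ.decomposition, Finset.sum_add_distrib]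
  linarith

end Potential

/-! ### Duality and contraction of entropy -/

/-- Gibbs' variational inequality: `∫ log w dμ ≤ KL(μ | ν)` when `∫ w dν ≤ 1`. -/
theorem integral_log_le_integral_llr {α : Type*} [MeasurableSpace α] {μ ν : Measure α}
    [IsProbabilityMeasure μ] [IsProbabilityMeasure ν] (hμν : μ ≪ ν) (hint : Integrable (llr μ ν) μ)
    {w : α → ℝ≥0∞} (hw : Measurable w) (hw1 : ∫⁻ x, w x ∂ν ≤ 1) (hw0 : ∀ᵐ x ∂μ, w x ≠ 0)
    (hwint : Integrable (fun x => Real.log (w x).toReal) μ) :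
    ∫ x, Real.log (w x).toReal ∂μ ≤ ∫ x, llr μ ν x ∂μ := by
  let r := μ.rnDeriv ν
  have hr : Measurable r := Measure.measurable_rnDeriv μ ν
  have hq : Measurable fun x => w x / r x := hw.div hr
  -- The bound `r * (w / r) ≤ w` holds even where `r` is 0 or `∞`. With `log t ≤ t - 1` at `t = w /
  -- r`, this total mass bound gives the inequality.
  have hle : ∫⁻ x, w x / r x ∂μ ≤ 1 := by
    rw [← lintegral_rnDeriv_mul hμν hq.aemeasurable]
    exact (lintegral_mono fun x => ENNReal.mul_div_le).trans hw1
  have hwtop : ∀ᵐ x ∂μ, w x ≠ ∞ :=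
    hμν.ae_le ((ae_lt_top hw (hw1.trans_lt ENNReal.one_lt_top).ne).mono fun x hx => hx.ne)
  have hqint : Integrable (fun x => (w x / r x).toReal) μ :=
    integrable_toReal_of_lintegral_ne_top hq.aemeasurable
      (hle.trans_lt ENNReal.one_lt_top).ne
  have hq1 : ∫ x, (w x / r x).toReal ∂μ ≤ 1 := by
    rw [integral_toReal hq.aemeasurable
      (ae_lt_top hq (hle.trans_lt ENNReal.one_lt_top).ne)]
    exact ENNReal.toReal_mono ENNReal.one_ne_top hle
  have hpt : ∀ᵐ x ∂μ, Real.log (w x).toReal - llr μ ν x ≤ (w x / r x).toReal - 1 := by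
    filter_upwards [hw0, hwtop, Measure.rnDeriv_pos hμν, hμν.ae_le (Measure.rnDeriv_lt_top μ ν)]
      with x h0 ht hr0 hrt
    have hwp : 0 < (w x).toReal := ENNReal.toReal_pos h0 ht
    have hrp : 0 < (r x).toReal := ENNReal.toReal_pos hr0.ne' hrt.ne
    rw [llr, ← Real.log_div hwp.ne' hrp.ne', ENNReal.toReal_div]
    exact Real.log_le_sub_one_of_pos (div_pos hwp hrp)
  have h := integral_mono_ae (hwint.sub hint) (hqint.sub (integrable_const 1)) hpt
  simp only [Pi.sub_apply] at h
  rw [integral_sub hwint hint, integral_sub hqint (integrable_const 1)] at h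
  simp only [integral_const, probReal_univ, smul_eq_mul, mul_one] at h
  linarith

section Contraction

variable {M : ℕ} {d : Fin M → ℕ} {π : Measure (BlockSpace d)} {U U₀ : BlockSpace d → ℝ}
  {V : ∀ m : Fin M, EuclideanSpace ℝ (Fin (d m)) → ℝ} {L : Fin M → ℝ≥0} {lam : ℝ}

theorem eraseBlock_update (m : Fin M) (x : BlockSpace d) (z : EuclideanSpace ℝ (Fin (d m))) :
    eraseBlock d m (Function.update x m z) = eraseBlock d m x := by
  funext i
  exact Function.update_of_ne i.2 _ _

theorem isProbabilityMeasure_marginalErase (m : Fin M) (μ : Measure (BlockSpace d))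
    [IsProbabilityMeasure μ] : IsProbabilityMeasure (marginalErase m μ) :=
  Measure.isProbabilityMeasure_map (measurable_eraseBlock d m).aemeasurable

theorem lintegral_gibbsMeasure (hU : Measurable U) {f : BlockSpace d → ℝ≥0∞} (hf : Measurable f) :
    ∫⁻ x, f x ∂gibbsMeasure U = ∫⁻ x, f x * ENNReal.ofReal (Real.exp (-U x)) := by
  rw [gibbsMeasure, lintegral_withDensity_eq_lintegral_mul _ (by fun_prop) hf]
  simp [mul_comm]

/-- The dual form of the contraction of entropy: a Brascamp-Lieb type inequality for functions
which do not depend on one of the blocks. -/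
theorem BlockAssumption.lintegral_prod_rpow_le (hπ : BlockAssumption π U U₀ V L lam) {l : ℝ}
    (hl0 : 0 < l) (hl1 : l < 1) (hlam : l ≤ lam) (hM : l < M)
    {g : ∀ m : Fin M, BlockSpaceErase d m → ℝ≥0∞} (hg : ∀ m, Measurable (g m)) :
    (∫⁻ x, ∏ m, g m (eraseBlock d m x) ^ (1 / ((M : ℝ) - l)) ∂π) ^ ((M : ℝ) - l) ≤
      ∏ m, ∫⁻ x, g m x ∂marginalErase m π := by
  have := hπ.isProbabilityMeasure
  have hU : Measurable U := hπ.continuous.measurable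
  have ha : 0 < (M : ℝ) - l := sub_pos.2 hM
  have hge : ∀ m, Measurable fun x => g m (eraseBlock d m x) := fun m =>
    (hg m).comp (measurable_eraseBlock d m)
  let E : BlockSpace d → ℝ≥0∞ := fun x => ENNReal.ofReal (Real.exp (-U x))
  have hE : Measurable E := by fun_prop
  have hw : Measurable fun x => ∏ m, g m (eraseBlock d m x) ^ (1 / ((M : ℝ) - l)) :=
    Finset.measurable_prod _ fun m _ => (hge m).pow_const _
  have hEint : ∫⁻ x, E x = 1 := by
    have h := measure_univ (μ := π)
    rw [hπ.eq_gibbs, ← lintegral_one, lintegral_gibbsMeasure hU measurable_const] at h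
    simpa using h
  have key := prekopaLeindler_blocks hl0 hl1
    (F := fun x => (∏ m, g m (eraseBlock d m x) ^ (1 / ((M : ℝ) - l))) * E x) (G := E)
    (h := fun m x => g m (eraseBlock d m x) * E x) (hw.mul hE) hE (fun m => (hge m).mul hE)
    fun x y => by
      simp only [eraseBlock_update]
      rw [ENNReal.mul_rpow_of_nonneg _ _ ha.le, ← ENNReal.prod_rpow_of_nonneg ha.le,
        Finset.prod_mul_distrib, mul_assoc]
      refine mul_le_mul' (le_of_eq ?_) ?_
      · refine Finset.prod_congr rfl fun m _ => ?_
        rw [← ENNReal.rpow_mul, div_mul_cancel₀ _ ha.ne', ENNReal.rpow_one]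
      -- After taking logarithms, the remaining inequality between products of `exp (-U)` is
      -- `sum_update_le`.
      · simp only [E]
        rw [ENNReal.ofReal_rpow_of_pos (Real.exp_pos _), ENNReal.ofReal_rpow_of_pos (Real.exp_pos _),
          ← ENNReal.ofReal_mul (by positivity),
          ← ENNReal.ofReal_prod_of_nonneg fun m _ => (Real.exp_pos _).le, ← Real.exp_sum,
          ← Real.exp_mul, ← Real.exp_mul, ← Real.exp_add]
        refine ENNReal.ofReal_le_ofReal (Real.exp_le_exp.2 ?_)
        rw [Finset.sum_neg_distrib]
        linarith [hπ.sum_update_le hl0.le hl1.le hlam x y]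
  rw [hEint, ENNReal.one_rpow, mul_one, ← lintegral_gibbsMeasure hU hw, ← hπ.eq_gibbs] at key
  refine key.trans_eq (Finset.prod_congr rfl fun m _ => ?_)
  rw [← lintegral_gibbsMeasure hU (hge m), ← hπ.eq_gibbs, marginalErase,
    lintegral_map (hg m) (measurable_eraseBlock d m)]

/-- The test function for Gibbs' inequality is the product of the marginal densities to the power `1
/ (M - l)`; its logarithm integrates against `μ` to the sum of the marginal entropies divided by `M
- l`. -/
theorem BlockAssumption.sum_integral_llr_le (hπ : BlockAssumption π U U₀ V L lam) {l : ℝ}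
    (hl0 : 0 < l) (hl1 : l < 1) (hlam : l ≤ lam) (hM : l < M) {μ : Measure (BlockSpace d)}
    [IsProbabilityMeasure μ] (hμπ : μ ≪ π) (hint : Integrable (llr μ π) μ) :
    ∑ m, ∫ x, llr (marginalErase m μ) (marginalErase m π) x ∂marginalErase m μ ≤
      ((M : ℝ) - l) * ∫ x, llr μ π x ∂μ := by
  have := hπ.isProbabilityMeasure
  have hμm := fun m => isProbabilityMeasure_marginalErase m μ
  have hπm := fun m => isProbabilityMeasure_marginalErase m π
  have ha : 0 < (M : ℝ) - l := sub_pos.2 hM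
  have hme := measurable_eraseBlock d
  have hac : ∀ m, marginalErase m μ ≪ marginalErase m π := fun m => hμπ.map (hme m)
  have hllr : ∀ m, Integrable (llr (marginalErase m μ) (marginalErase m π)) (marginalErase m μ) :=
    fun m => integrable_llr_map hμπ (hme m) hint
  let g : ∀ m, BlockSpaceErase d m → ℝ≥0∞ := fun m =>
    (marginalErase m μ).rnDeriv (marginalErase m π)
  have hg : ∀ m, Measurable (g m) := fun m => Measure.measurable_rnDeriv _ _
  let w : BlockSpace d → ℝ≥0∞ := fun x => ∏ m, g m (eraseBlock d m x) ^ (1 / ((M : ℝ) - l))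
  have hw : Measurable w :=
    Finset.measurable_prod _ fun m _ => ((hg m).comp (hme m)).pow_const _
  have hw1 : ∫⁻ x, w x ∂π ≤ 1 := by
    have h := hπ.lintegral_prod_rpow_le hl0 hl1 hlam hM hg
    have h1 : ∏ m, ∫⁻ x, g m x ∂marginalErase m π = 1 :=
      Finset.prod_eq_one fun m _ => by
        rw [Measure.lintegral_rnDeriv (hac m), measure_univ]
    rw [h1] at h
    have h2 := ENNReal.rpow_le_rpow h (inv_nonneg.2 ha.le)
    rwa [ENNReal.rpow_rpow_inv ha.ne', ENNReal.one_rpow] at h2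
  have hgood : ∀ᵐ x ∂μ, ∀ m, 0 < g m (eraseBlock d m x) ∧ g m (eraseBlock d m x) < ∞ := by
    refine ae_all_iff.2 fun m => ?_
    have h : ∀ᵐ y ∂marginalErase m μ, 0 < g m y ∧ g m y < ∞ :=
      (Measure.rnDeriv_pos (hac m)).and ((hac m).ae_le (Measure.rnDeriv_lt_top _ _))
    exact ae_of_ae_map (hme m).aemeasurable h
  have hlog : (fun x => Real.log (w x).toReal) =ᵐ[μ] fun x => ∑ m, 1 / ((M : ℝ) - l) *
      llr (marginalErase m μ) (marginalErase m π) (eraseBlock d m x) := by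
    filter_upwards [hgood] with x hx
    have hpos : ∀ m, 0 < (g m (eraseBlock d m x)).toReal := fun m =>
      ENNReal.toReal_pos (hx m).1.ne' (hx m).2.ne
    simp only [w, ENNReal.toReal_prod, ← ENNReal.toReal_rpow]
    rw [Real.log_prod fun m _ => (Real.rpow_pos_of_pos (hpos m) _).ne']
    exact Finset.sum_congr rfl fun m _ => Real.log_rpow (hpos m) _
  have hint' : ∀ m, Integrable
      (fun x => llr (marginalErase m μ) (marginalErase m π) (eraseBlock d m x)) μ := fun m =>
    (hllr m).comp_measurable (hme m)
  have hwint : Integrable (fun x => Real.log (w x).toReal) μ :=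
    (integrable_finsetSum _ fun m _ => (hint' m).const_mul _).congr hlog.symm
  have hw0 : ∀ᵐ x ∂μ, w x ≠ 0 := by
    filter_upwards [hgood] with x hx
    exact Finset.prod_ne_zero_iff.2 fun m _ =>
      (ENNReal.rpow_pos (hx m).1 (hx m).2.ne).ne'
  have h := integral_log_le_integral_llr hμπ hint hw hw1 hw0 hwint
  rw [integral_congr_ae hlog, integral_finsetSum _ fun m _ => (hint' m).const_mul _] at h
  simp only [integral_const_mul] at h
  rw [← Finset.mul_sum, one_div_mul_eq_div, div_le_iff₀' ha] at h
  refine le_trans (le_of_eq (Finset.sum_congr rfl fun m _ => ?_)) h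
  rw [marginalErase, integral_map (hme m).aemeasurable]
  exact (stronglyMeasurable_llr _ _).aestronglyMeasurable

end Contraction

theorem mainTheorem1 {M : ℕ} (d : Fin M → ℕ) (π : Measure (BlockSpace d))
    (U U₀ : BlockSpace d → ℝ) (V : ∀ m : Fin M, EuclideanSpace ℝ (Fin (d m)) → ℝ)
    (L : Fin M → ℝ≥0) (lam : ℝ)
    (hπ : BlockAssumption π U U₀ V L lam)
    (hL : ∃ m, 0 < d m ∧ 0 < L m)
    (μ : Measure (BlockSpace d)) [IsProbabilityMeasure μ] :
    (1 / (M : ℝ≥0∞)) * ∑ m : Fin M, klDiv (marginalErase m μ) (marginalErase m π)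
      ≤ ENNReal.ofReal (1 - 1 / (blockConditionNumber lam * (M : ℝ))) * klDiv μ π := by
  have := hπ.isProbabilityMeasure
  have hμm := fun m => isProbabilityMeasure_marginalErase m μ
  have hπm := fun m => isProbabilityMeasure_marginalErase m π
  have hlam1 := hπ.le_one hL
  have hlam0 := hπ.lam_pos
  have hM0 : 0 < M := Fin.pos_iff_nonempty.2 ⟨hL.choose⟩
  have hconst : 1 - 1 / (blockConditionNumber lam * (M : ℝ)) = ((M : ℝ) - lam) / M := by
    have : (M : ℝ) ≠ 0 := by positivity
    rw [blockConditionNumber]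
    field_simp
  rw [hconst]
  -- For `M = 1` and `lam = 1` the constant is 0 and the right side is 0 even if `klDiv μ π = ∞`.
  -- The left side vanishes because the marginals live on a one-point space.
  rcases Nat.lt_or_ge 1 M with hM | hM
  swap
  · have hM1 : M = 1 := le_antisymm hM hM0
    subst hM1
    have hzero : ∀ m, klDiv (marginalErase m μ) (marginalErase m π) = 0 := by
      intro m
      have : IsEmpty {i : Fin 1 // i ≠ m} := ⟨fun i => i.2 (Subsingleton.elim _ _)⟩
      refine klDiv_eq_zero_iff.2 (Measure.ext fun s _ => ?_)
      rcases Set.eq_empty_or_nonempty s with rfl | hs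
      · simp
      · rw [Subsingleton.eq_univ_of_nonempty hs, measure_univ, measure_univ]
    simp [hzero]
  have hMr : (1 : ℝ) < M := by exact_mod_cast hM
  have ha : 0 < (M : ℝ) - lam := by linarith
  by_cases htop : klDiv μ π = ∞
  · rw [htop, ENNReal.mul_top]
    · exact le_top
    · exact (ENNReal.ofReal_pos.2 (by positivity)).ne'
  obtain ⟨hac, hint⟩ := klDiv_ne_top_iff.1 htop
  have hllr : ∀ m, Integrable (llr (marginalErase m μ) (marginalErase m π)) (marginalErase m μ) :=
    fun m => integrable_llr_map hac (measurable_eraseBlock d m) hint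
  have hacm : ∀ m, marginalErase m μ ≪ marginalErase m π := fun m =>
    hac.map (measurable_eraseBlock d m)
  have hsum : ∑ m, ∫ x, llr (marginalErase m μ) (marginalErase m π) x ∂marginalErase m μ ≤
      ((M : ℝ) - lam) * ∫ x, llr μ π x ∂μ := by
    -- The contraction was proved for `l < 1` only, while `lam = 1` is possible, so the constant is
    -- reached as a limit from below.
    have htend : Filter.Tendsto (fun l : ℝ => ((M : ℝ) - l) * ∫ x, llr μ π x ∂μ)
        (nhdsWithin lam (Set.Iio lam)) (nhds (((M : ℝ) - lam) * ∫ x, llr μ π x ∂μ)) :=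
      ((continuous_const.sub continuous_id).mul continuous_const).continuousWithinAt
    refine ge_of_tendsto htend ?_
    filter_upwards [Ioo_mem_nhdsLT hlam0] with l hl
    exact hπ.sum_integral_llr_le hl.1 (hl.2.trans_le hlam1) hl.2.le
      (by linarith [hl.2]) hac hint
  have hkl : ∀ m, klDiv (marginalErase m μ) (marginalErase m π) =
      ENNReal.ofReal (∫ x, llr (marginalErase m μ) (marginalErase m π) x ∂marginalErase m μ) := by
    intro m
    rw [klDiv_of_ac_of_integrable (hacm m) (hllr m)]
    simp
  have hkl0 : ∀ m, 0 ≤ ∫ x, llr (marginalErase m μ) (marginalErase m π) x ∂marginalErase m μ := by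
    intro m
    simpa using integral_llr_add_sub_measure_univ_nonneg (hacm m) (hllr m)
  rw [Finset.sum_congr rfl fun m _ => hkl m, ← ENNReal.ofReal_sum_of_nonneg fun m _ => hkl0 m,
    klDiv_of_ac_of_integrable hac hint, probReal_univ, probReal_univ, add_sub_cancel_right,
    ← ENNReal.ofReal_mul (by positivity), one_div, ← ENNReal.ofReal_natCast,
    ← ENNReal.ofReal_inv_of_pos (by positivity), ← ENNReal.ofReal_mul (by positivity)]
  refine ENNReal.ofReal_le_ofReal ?_
  rw [div_mul_eq_mul_div, inv_mul_eq_div]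
  gcongr
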